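/- Let $\mathbb{D}$ be the open unit disk and $0<p<\infty$. Let $H^p$ be the set of all analytic $f:\mathbb{D}\to\mathbb{C}$ with $\sup_{0\le r<1}\frac1{2\pi}\int_0^{2\pi}|f(re^{it})|^p\,dt<\infty$, and let $S^p$ be the set of all analytic $f:\mathbb{D}\to\mathbb{C}$ with $f'\in H^p$. Call a map $T$ invertible on $S^p$ if $T$ maps $S^p$ into itself and has a two-sided inverse $S^p\to S^p$. A function $g$ on $\mathbb{D}$ is a multiplier of $S^p$ if $gf\in S^p$ for every $f\in S^p$. Let $\varphi:\mathbb{D}\to\mathbb{D}$ be analytic. 1. The composition operator $C_\varphi f=f\circ\varphi$ is invertible on $S^p$ if and only if $\varphi$ is an automorphism of $\mathbb{D}$ (an analytic bijection of $\mathbb{D}$ with analytic inverse). 2. For every analytic $\psi:\mathbb{D}\to\mathbb{C}$, the weighted composition operator $W_{\psi,\varphi}f=\psi\cdot(f\circ\varphi)$ is invertible on $S^p$ if and only if $\varphi$ is an automorphism of $\mathbb{D}$, $\psi$ has no zeros in $\mathbb{D}$, and both $\psi$ and $1/\psi$ are multipliers of $S^p$. -/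

import Mathlib

namespace DiscSpaces

open scoped Complex.UnitDisc

noncomputable section

/-- The extension by zero to all of `ℂ` of a function on the open unit disc. -/
def ext (f : 𝔻 → ℂ) : ℂ → ℂ :=
  Function.extend ((↑) : 𝔻 → ℂ) f 0

/-- `f` belongs to `H(𝔻)`: it is holomorphic (equivalently, analytic) on the open unit disc. -/
def Holomorphic (f : 𝔻 → ℂ) : Prop :=
  DifferentiableOn ℂ (ext f) (Metric.ball 0 1)

/-- The complex derivative `f'`, as a function on the disc. The disc is open, so the extension of
`f` outside of it plays no role. -/
def derivative (f : 𝔻 → ℂ) : 𝔻 → ℂ :=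
  fun z => deriv (ext f) (z : ℂ)

/-- The Hardy space `H^p` of the disc, `0 < p < ∞`: all holomorphic `f` such that
`sup_{0 ≤ r < 1} (1 / 2π) ∫_0^{2π} |f (r e^{it})|^p dt` is finite. (The integrands are continuous
when `f` is holomorphic and `p > 0`.) -/
def hardySpace (p : ℝ) : Set (𝔻 → ℂ) :=
  {f | Holomorphic f ∧
    BddAbove ((fun r : ℝ => Real.circleAverage (fun z => ‖ext f z‖ ^ p) 0 r) '' Set.Ico 0 1)}

/-- The space `S^p` of all holomorphic functions on the disc with derivative in `H^p`. -/
def spaceS (p : ℝ) : Set (𝔻 → ℂ) :=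
  {f | Holomorphic f ∧ derivative f ∈ hardySpace p}

/-- The composition operator `C_φ f = f ∘ φ`. -/
def compOp (φ : 𝔻 → 𝔻) (f : 𝔻 → ℂ) : 𝔻 → ℂ :=
  f ∘ φ

/-- The weighted composition operator `W_{ψ,φ} f = ψ · (f ∘ φ)`. -/
def weightedCompOp (ψ : 𝔻 → ℂ) (φ : 𝔻 → 𝔻) (f : 𝔻 → ℂ) : 𝔻 → ℂ :=
  fun z => ψ z * f (φ z)

/-- `T` is an invertible map on the set `X` of functions: it takes `X` into itself, and there is a
map `R` of `X` into itself which is a two-sided inverse of `T` on `X`. -/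
def InvertibleOn (T : (𝔻 → ℂ) → (𝔻 → ℂ)) (X : Set (𝔻 → ℂ)) : Prop :=
  Set.MapsTo T X X ∧
    ∃ R : (𝔻 → ℂ) → (𝔻 → ℂ), Set.MapsTo R X X ∧ Set.InvOn R T X X

/-- `g` is a multiplier of the set `X`: `g f ∈ X` whenever `f ∈ X`. -/
def IsMultiplier (g : 𝔻 → ℂ) (X : Set (𝔻 → ℂ)) : Prop :=
  ∀ f ∈ X, g * f ∈ X

/-- `φ` is an automorphism of the disc: a holomorphic self-map with a holomorphic inverse. -/
def IsAutomorphism (φ : 𝔻 → 𝔻) : Prop :=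
  Holomorphic (fun z => (φ z : ℂ)) ∧
    ∃ σ : 𝔻 → 𝔻, Holomorphic (fun z => (σ z : ℂ)) ∧
      Function.LeftInverse σ φ ∧ Function.RightInverse σ φ

end

end DiscSpaces

namespace DiscSpaces

open scoped Complex.UnitDisc ComplexConjugate
open Set Filter Topology Metric

/-! Necessity uses only surjectivity. Preimages `F`, `G` of `1` and `z` give a meromorphic `Q = G /
F` on the disc with `Q ∘ φ = id`, so `φ` is injective with open image. Were the image not the whole
disc, it would have a boundary point `a` in the disc; there `‖Q‖ → 1` along the image, so `Q` tends
to a unimodular `c`, and `1 - conj c * Q` has a zero of some finite order `k ≥ 1`. A preimage `L` of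
`(1 - conj c * z) ^ (1 + 1/N)`, a member of `S^p`, makes `L / F` a meromorphic `N`-th root of `(1 -
conj c * Q) ^ (N + 1)`, so `N ∣ k`; this fails for `N = k + 1` (`isAutomorphism_of_surjOn`).

Sufficiency rests on `(f ∘ φ)' = (f' ∘ φ) φ'`: Schwarz's lemma makes an automorphism a Möbius map
with bounded derivative, and Littlewood subordination keeps `f' ∘ φ` in `H^p`. Weights are then
handled by composing with `C_φ` and its inverse. -/

/-! ### Zero extensions, membership in `S^p`, test functions -/

theorem ext_coe (f : 𝔻 → ℂ) (z : 𝔻) : ext f z = f z :=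
  Complex.UnitDisc.coe_injective.extend_apply _ _ _

theorem exists_coe_eq {z : ℂ} (hz : z ∈ ball (0 : ℂ) 1) : ∃ w : 𝔻, (w : ℂ) = z :=
  ⟨.mk z (mem_ball_zero_iff.1 hz), rfl⟩

theorem coe_mem_ball (z : 𝔻) : (z : ℂ) ∈ ball (0 : ℂ) 1 :=
  mem_ball_zero_iff.2 z.norm_lt_one

theorem eqOn_ext {f : 𝔻 → ℂ} {U : ℂ → ℂ} (h : ∀ z : 𝔻, f z = U z) :
    EqOn (ext f) U (ball 0 1) := by
  intro z hz
  obtain ⟨w, rfl⟩ := exists_coe_eq hz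
  rw [ext_coe, h]

theorem holomorphic_of_eq {f : 𝔻 → ℂ} {U : ℂ → ℂ} (hU : DifferentiableOn ℂ U (ball 0 1))
    (h : ∀ z : 𝔻, f z = U z) : Holomorphic f :=
  hU.congr (eqOn_ext h)

theorem Holomorphic.analyticAt {f : 𝔻 → ℂ} (hf : Holomorphic f) {z : ℂ}
    (hz : z ∈ ball (0 : ℂ) 1) : AnalyticAt ℂ (ext f) z :=
  DifferentiableOn.analyticAt hf (isOpen_ball.mem_nhds hz)

/-- The defining condition of `spaceS p`, stated for a function on `ℂ` that agrees with the given
one on the disc. -/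
theorem mem_spaceS_iff {p : ℝ} {f : 𝔻 → ℂ} {U : ℂ → ℂ} (hU : DifferentiableOn ℂ U (ball 0 1))
    (h : ∀ z : 𝔻, f z = U z) :
    f ∈ spaceS p ↔
      ∃ M, ∀ r ∈ Ico (0 : ℝ) 1, Real.circleAverage (fun z => ‖deriv U z‖ ^ p) 0 r ≤ M := by
  have hd : EqOn (ext (derivative f)) (deriv U) (ball 0 1) := by
    refine eqOn_ext fun z => ?_
    exact Filter.EventuallyEq.deriv_eq
      ((eqOn_ext h).eventuallyEq_of_mem (isOpen_ball.mem_nhds (coe_mem_ball z)))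
  have hol : Holomorphic (derivative f) :=
    (hU.deriv isOpen_ball).congr hd
  have key : ∀ r ∈ Ico (0 : ℝ) 1,
      Real.circleAverage (fun z => ‖ext (derivative f) z‖ ^ p) 0 r =
        Real.circleAverage (fun z => ‖deriv U z‖ ^ p) 0 r := by
    intro r hr
    refine Real.circleAverage_congr_sphere fun z hz => ?_
    have hz' : z ∈ ball (0 : ℂ) 1 := by
      rw [mem_sphere_zero_iff_norm, abs_of_nonneg hr.1] at hz
      exact mem_ball_zero_iff.2 (hz ▸ hr.2)
    simp only [hd hz']
  constructor
  · rintro ⟨-, -, M, hM⟩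
    exact ⟨M, fun r hr => key r hr ▸ hM ⟨r, hr, rfl⟩⟩
  · rintro ⟨M, hM⟩
    refine ⟨holomorphic_of_eq hU h, hol, M, ?_⟩
    rintro _ ⟨r, hr, rfl⟩
    exact (key r hr).trans_le (hM r hr)

theorem circleIntegrable_norm_rpow {p : ℝ} (hp : 0 ≤ p) {V : ℂ → ℂ} {r R : ℝ}
    (hV : ContinuousOn V (ball 0 R)) (hr : |r| < R) :
    CircleIntegrable (fun z => ‖V z‖ ^ p) 0 r := by
  refine ContinuousOn.circleIntegrable' ?_
  refine (hV.mono ?_).norm.rpow_const fun _ _ => Or.inr hp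
  exact fun z hz => mem_ball_zero_iff.2 ((mem_sphere_zero_iff_norm.1 hz).trans_lt hr)

theorem mem_spaceS_of_norm_deriv_le {p : ℝ} (hp : 0 < p) {f : 𝔻 → ℂ} {U : ℂ → ℂ}
    (hU : DifferentiableOn ℂ U (ball 0 1)) (h : ∀ z : 𝔻, f z = U z) {C : ℝ}
    (hC : ∀ z ∈ ball (0 : ℂ) 1, ‖deriv U z‖ ≤ C) : f ∈ spaceS p := by
  refine (mem_spaceS_iff hU h).2 ⟨C ^ p, fun r hr => ?_⟩
  have hr' : |r| < 1 := (abs_of_nonneg hr.1).trans_lt hr.2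
  refine Real.circleAverage_mono_on_of_le_circle
    (circleIntegrable_norm_rpow hp.le (hU.deriv isOpen_ball).continuousOn hr') fun z hz => ?_
  exact Real.rpow_le_rpow (norm_nonneg _)
    (hC z (mem_ball_zero_iff.2 ((mem_sphere_zero_iff_norm.1 hz).trans_lt hr'))) hp.le

theorem one_mem_spaceS {p : ℝ} (hp : 0 < p) : (fun _ => 1 : 𝔻 → ℂ) ∈ spaceS p :=
  mem_spaceS_of_norm_deriv_le (U := fun _ => 1) (C := 0) hp (by fun_prop) (fun _ => rfl)
    (by simp)

theorem coe_mem_spaceS {p : ℝ} (hp : 0 < p) : (fun z => (z : ℂ) : 𝔻 → ℂ) ∈ spaceS p :=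
  mem_spaceS_of_norm_deriv_le (U := fun z => z) (C := 1) hp (by fun_prop) (fun _ => rfl)
    (by simp)

/-- Since `1 - c * z` has positive real part, the principal power with exponent `1 + 1/N` is
analytic, and its derivative, a multiple of the power `1/N`, is bounded. -/
theorem exists_mem_spaceS_pow_eq {p : ℝ} (hp : 0 < p) {c : ℂ} (hc : ‖c‖ = 1) {N : ℕ}
    (hN : N ≠ 0) :
    ∃ g ∈ spaceS p, ∀ z : 𝔻, g z ^ N = (1 - c * z) ^ (N + 1) := by
  set e : ℂ := (((N + 1 : ℝ) / N : ℝ) : ℂ) with he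
  have hN' : (N : ℝ) ≠ 0 := by exact_mod_cast hN
  have hNc : (N : ℂ) ≠ 0 := by exact_mod_cast hN
  have hlt : ∀ z ∈ ball (0 : ℂ) 1, ‖c * z‖ < 1 := by
    intro z hz
    rw [norm_mul, hc, one_mul]
    exact mem_ball_zero_iff.1 hz
  have hslit : ∀ z ∈ ball (0 : ℂ) 1, 1 - c * z ∈ Complex.slitPlane := by
    intro z hz
    refine Or.inl ?_
    have := (Complex.re_le_norm (c * z)).trans_lt (hlt z hz)
    rw [Complex.sub_re, Complex.one_re]
    linarith
  have hder : ∀ z ∈ ball (0 : ℂ) 1,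
      HasDerivAt (fun z => (1 - c * z) ^ e) (e * (1 - c * z) ^ (e - 1) * (-c)) z := by
    intro z hz
    have h1 : HasDerivAt (fun z => 1 - c * z) (-c) z := by
      simpa using ((hasDerivAt_id z).const_mul c).const_sub 1
    exact h1.cpow_const (hslit z hz)
  refine ⟨fun z => (1 - c * z) ^ e, ?_, fun z => ?_⟩
  · refine mem_spaceS_of_norm_deriv_le (U := fun z => (1 - c * z) ^ e)
      (C := ‖e‖ * 2 ^ ((1 : ℝ) / N)) hp
      (fun z hz => (hder z hz).differentiableAt.differentiableWithinAt) (fun _ => rfl) ?_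
    intro z hz
    have h1 : e - 1 = (((1 : ℝ) / N : ℝ) : ℂ) := by
      rw [he]
      push_cast
      field_simp
      ring
    rw [(hder z hz).deriv, norm_mul, norm_mul, norm_neg, hc, mul_one, h1,
      Complex.norm_cpow_real]
    gcongr
    calc ‖1 - c * z‖ ≤ ‖(1 : ℂ)‖ + ‖c * z‖ := norm_sub_le _ _
      _ ≤ 2 := by rw [norm_one]; linarith [hlt z hz]
  · dsimp only
    rw [← Complex.cpow_mul_nat]
    have h2 : e * N = ((N + 1 : ℕ) : ℂ) := by
      rw [he]
      push_cast
      field_simp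
    rw [h2, Complex.cpow_natCast]

/-! ### Surjectivity forces an automorphism -/

/-- If `Q` is meromorphic at `a` and tends to the unit circle along a set accumulating at `a`, then
it has a unimodular limit at `a`. -/
theorem exists_tendsto_of_norm_tendsto_one {Q : ℂ → ℂ} {a : ℂ} (hQ : MeromorphicAt Q a)
    {l : Filter ℂ} [l.NeBot] (hl : l ≤ 𝓝[≠] a) (h : Tendsto (fun w => ‖Q w‖) l (𝓝 1)) :
    ∃ c, ‖c‖ = 1 ∧ Tendsto Q (𝓝[≠] a) (𝓝 c) := by
  have h0 : 0 ≤ meromorphicOrderAt Q a := by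
    by_contra hneg
    have := (tendsto_cobounded_of_meromorphicOrderAt_neg (not_le.1 hneg)).mono_left hl
    exact not_tendsto_nhds_of_tendsto_atTop (tendsto_norm_atTop_iff_cobounded.2 this) 1 h
  obtain ⟨c, hc⟩ := tendsto_nhds_of_meromorphicOrderAt_nonneg hQ h0
  exact ⟨c, tendsto_nhds_unique (hc.mono_left hl).norm h, hc⟩

/-- A meromorphic function that vanishes at `a` has no meromorphic `N`-th root of its
`(N + 1)`-st power for a suitable `N`. -/
theorem exists_pow_ne_pow {T : ℂ → ℂ} {a : ℂ} (hT : MeromorphicAt T a)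
    (h0 : Tendsto T (𝓝[≠] a) (𝓝 0)) (hne : ∃ᶠ w in 𝓝[≠] a, T w ≠ 0) :
    ∃ N : ℕ, N ≠ 0 ∧ ∀ S : ℂ → ℂ, MeromorphicAt S a →
      ¬ ∃ᶠ w in 𝓝[≠] a, S w ^ N = T w ^ (N + 1) := by
  have hpos := (tendsto_zero_iff_meromorphicOrderAt_pos hT).1 h0
  have htop : meromorphicOrderAt T a ≠ ⊤ := fun h =>
    hne (by simpa using meromorphicOrderAt_eq_top_iff.1 h)
  obtain ⟨k, hk⟩ := WithTop.ne_top_iff_exists.1 htop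
  rw [← hk] at hpos
  have hk0 : 0 < k := by exact_mod_cast hpos
  -- With `k` the order of `T` and `m` that of `S`, comparing orders gives `N * m = (N + 1) * k`, so
  -- `N ∣ k`; the choice `N = k + 1` exceeds `k > 0`.
  refine ⟨k.toNat + 1, by simp, fun S hS hf => ?_⟩
  have he := ((hS.pow (k.toNat + 1)).frequently_eq_iff_eventuallyEq
    (hT.pow (k.toNat + 1 + 1))).1 hf
  have ho := meromorphicOrderAt_congr he
  rw [meromorphicOrderAt_pow hS, meromorphicOrderAt_pow hT, ← hk] at ho
  have hStop : meromorphicOrderAt S a ≠ ⊤ := by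
    intro h
    rw [h, WithTop.mul_top (Nat.cast_ne_zero.2 (Nat.succ_ne_zero k.toNat))] at ho
    exact WithTop.coe_ne_top ho.symm
  obtain ⟨m, hm⟩ := WithTop.ne_top_iff_exists.1 hStop
  rw [← hm] at ho
  have ho' : ((k.toNat + 1 : ℕ) : ℤ) * m = ((k.toNat + 1 + 1 : ℕ) : ℤ) * k := by exact_mod_cast ho
  have hkk : ((k.toNat : ℕ) : ℤ) = k := Int.toNat_of_nonneg hk0.le
  push_cast at ho'
  rw [hkk] at ho'
  have hd : (k + 1) ∣ k := ⟨m - k, by linear_combination -ho'⟩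
  have := Int.le_of_dvd hk0 hd
  omega

/-- For `s < 1` the compact set `Φ '' closedBall 0 s` misses `a`, so image points close to `a` come
only from `‖z‖ > s`. -/
theorem norm_tendsto_one_of_leftInverse {Φ Q : ℂ → ℂ} (hΦ : ContinuousOn Φ (ball 0 1))
    (hQ : ∀ z ∈ ball (0 : ℂ) 1, Q (Φ z) = z) {a : ℂ} (ha : a ∉ Φ '' ball 0 1) :
    Tendsto (fun w => ‖Q w‖) (𝓝[Φ '' ball 0 1] a) (𝓝 1) := by
  refine tendsto_order.2 ⟨fun s hs => ?_, fun s hs => ?_⟩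
  · have hsub : closedBall (0 : ℂ) s ⊆ ball 0 1 := closedBall_subset_ball hs
    have hK : IsClosed (Φ '' closedBall 0 s) :=
      ((isCompact_closedBall 0 s).image_of_continuousOn (hΦ.mono hsub)).isClosed
    have hmem : (Φ '' closedBall 0 s)ᶜ ∈ 𝓝 a :=
      hK.isOpen_compl.mem_nhds fun h => ha (image_mono hsub h)
    filter_upwards [mem_nhdsWithin_of_mem_nhds hmem, self_mem_nhdsWithin] with w hw hw'
    obtain ⟨z, hz, rfl⟩ := hw'
    rw [hQ z hz]
    by_contra hle
    exact hw ⟨z, mem_closedBall_zero_iff.2 (not_lt.1 hle), rfl⟩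
  · filter_upwards [self_mem_nhdsWithin] with w hw'
    obtain ⟨z, hz, rfl⟩ := hw'
    rw [hQ z hz]
    exact (mem_ball_zero_iff.1 hz).trans hs

/-- If every function of `spaceS p` has the form `ψ · (L ∘ φ)` with `L` in `spaceS p`, then `φ` is an
automorphism of the disc. -/
theorem isAutomorphism_of_surjOn {p : ℝ} (hp : 0 < p) {φ : 𝔻 → 𝔻}
    (hφ : Holomorphic (fun z => (φ z : ℂ))) {ψ : 𝔻 → ℂ}
    (h : ∀ g ∈ spaceS p, ∃ L ∈ spaceS p, ∀ z, ψ z * L (φ z) = g z) : IsAutomorphism φ := by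
  obtain ⟨F, hF, hF1⟩ := h _ (one_mem_spaceS hp)
  obtain ⟨G, hG, hG1⟩ := h _ (coe_mem_spaceS hp)
  have hψ0 : ∀ z, ψ z ≠ 0 := fun z hz => by simpa [hz] using hF1 z
  have hF0 : ∀ z, F (φ z) ≠ 0 := fun z hz => by simpa [hz] using hF1 z
  have hdiv : ∀ (g L : 𝔻 → ℂ), (∀ z, ψ z * L (φ z) = g z) → ∀ z, L (φ z) / F (φ z) = g z := by
    intro g L hL z
    rw [div_eq_iff (hF0 z), ← hL z]
    linear_combination -L (φ z) * hF1 z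
  set Φ : ℂ → ℂ := ext fun z => (φ z : ℂ) with hΦ
  have hΦc : ∀ z : 𝔻, Φ z = φ z := fun z => ext_coe _ z
  set Q : ℂ → ℂ := ext G / ext F with hQdef
  have hQc : ∀ z : 𝔻, Q (φ z) = z := by
    intro z
    simp only [hQdef, Pi.div_apply, ext_coe]
    exact hdiv _ G hG1 z
  have hQΦ : ∀ z ∈ ball (0 : ℂ) 1, Q (Φ z) = z := by
    intro z hz
    obtain ⟨z, rfl⟩ := exists_coe_eq hz
    rw [hΦc, hQc]
  have hinj : Function.Injective φ := by
    intro x y hxy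
    apply Complex.UnitDisc.coe_injective
    rw [← hQc x, ← hQc y, hxy]
  have hQm : ∀ a ∈ ball (0 : ℂ) 1, MeromorphicAt Q a := fun a ha =>
    (hG.1.analyticAt ha).meromorphicAt.div (hF.1.analyticAt ha).meromorphicAt
  have hopen : IsOpen (Φ '' ball 0 1) := by
    have hΦan : AnalyticOnNhd ℂ Φ (ball 0 1) := fun z hz => hφ.analyticAt hz
    refine (hΦan.is_constant_or_isOpen (convex_ball _ _).isPreconnected).resolve_left ?_ _
      Subset.rfl isOpen_ball
    rintro ⟨w, hw⟩
    have h1 : ((1 / 2 : ℝ) : ℂ) ∈ ball (0 : ℂ) 1 := by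
      rw [mem_ball_zero_iff, Complex.norm_real]
      norm_num
    have h2 : (0 : ℂ) ∈ ball (0 : ℂ) 1 := by simp
    have h3 := hQΦ _ h1
    rw [hw _ h1, ← hw _ h2, hQΦ _ h2] at h3
    norm_num at h3
  have himage : Φ '' ball 0 1 ⊆ ball 0 1 := by
    rintro _ ⟨z, hz, rfl⟩
    obtain ⟨z, rfl⟩ := exists_coe_eq hz
    rw [hΦc]
    exact coe_mem_ball _
  have hsubset : ball (0 : ℂ) 1 ⊆ Φ '' ball 0 1 := by
    -- By connectedness it is enough that the open image is relatively closed in the disc.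
    refine (convex_ball (0 : ℂ) 1).isPreconnected.subset_of_closure_inter_subset hopen
      ⟨Φ 0, himage ⟨0, by simp, rfl⟩, 0, by simp, rfl⟩ ?_
    rintro a ⟨hacl, ha⟩
    by_contra haΩ
    have : (𝓝[Φ '' ball 0 1] a).NeBot := mem_closure_iff_nhdsWithin_neBot.1 hacl
    have hl : 𝓝[Φ '' ball 0 1] a ≤ 𝓝[≠] a :=
      nhdsWithin_mono _ fun w hw hwa => haΩ (mem_singleton_iff.1 hwa ▸ hw)
    have hfreq : ∀ P : ℂ → Prop, (∀ z : 𝔻, P (φ z)) → ∃ᶠ w in 𝓝[≠] a, P w := by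
      intro P hP
      refine Frequently.filter_mono (Eventually.frequently ?_) hl
      filter_upwards [self_mem_nhdsWithin] with w hw
      obtain ⟨z, hz, rfl⟩ := hw
      obtain ⟨z, rfl⟩ := exists_coe_eq hz
      rw [hΦc]
      exact hP z
    obtain ⟨c, hc, hlim⟩ := exists_tendsto_of_norm_tendsto_one (hQm a ha) hl
      (norm_tendsto_one_of_leftInverse (DifferentiableOn.continuousOn hφ) hQΦ haΩ)
    have hcc : conj c * c = 1 := by
      rw [Complex.conj_mul', hc]
      norm_num
    have hT0 : Tendsto (fun w => 1 - conj c * Q w) (𝓝[≠] a) (𝓝 0) := by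
      simpa [hcc] using (hlim.const_mul (conj c)).const_sub 1
    have hTm : MeromorphicAt (fun w => 1 - conj c * Q w) a :=
      (MeromorphicAt.const _ _).sub ((MeromorphicAt.const _ _).mul (hQm a ha))
    have hTne : ∃ᶠ w in 𝓝[≠] a, 1 - conj c * Q w ≠ 0 := by
      refine hfreq _ fun z hz => ?_
      rw [hQc, sub_eq_zero] at hz
      have := congrArg norm hz
      rw [norm_one, norm_mul, RCLike.norm_conj, hc, one_mul] at this
      exact z.norm_lt_one.ne' this
    obtain ⟨N, hN, hS⟩ := exists_pow_ne_pow hTm hT0 hTne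
    obtain ⟨g, hg, hgN⟩ := exists_mem_spaceS_pow_eq hp (c := conj c) (by rw [RCLike.norm_conj, hc]) hN
    obtain ⟨L, hL, hL1⟩ := h g hg
    refine hS (ext L / ext F)
      ((hL.1.analyticAt ha).meromorphicAt.div (hF.1.analyticAt ha).meromorphicAt)
      (hfreq _ fun z => ?_)
    rw [Pi.div_apply, ext_coe, ext_coe, hdiv g L hL1 z, hQc, hgN]
  have hsurj : Function.Surjective φ := by
    intro w
    obtain ⟨z, hz, hzw⟩ := hsubset (coe_mem_ball w)
    obtain ⟨z, rfl⟩ := exists_coe_eq hz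
    exact ⟨z, Complex.UnitDisc.coe_injective (by rw [← hzw, hΦc])⟩
  obtain ⟨σ, hσl, hσr⟩ := Function.bijective_iff_has_inverse.1 ⟨hinj, hsurj⟩
  refine ⟨hφ, σ, ?_, hσl, hσr⟩
  -- The inverse is `Q` itself: `F` has no zeros on the image of `φ`, which is now the whole disc.
  refine holomorphic_of_eq (U := Q) (DifferentiableOn.div hG.1 hF.1 fun w hw => ?_) fun w => ?_
  · obtain ⟨w, rfl⟩ := exists_coe_eq hw
    obtain ⟨z, rfl⟩ := hsurj w
    rw [ext_coe]
    exact hF0 z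
  · conv_rhs => rw [← hσr w]
    exact (hQc (σ w)).symm

/-! ### Removing zeros with Blaschke factors -/

theorem norm_sub_mul_le_norm_sub_conj_mul {R : ℝ} {z u : ℂ} (hR : 0 ≤ R) (hz : ‖z‖ ≤ R)
    (hu : ‖u‖ ≤ R) : ‖z - u‖ * R ≤ ‖(R : ℂ) ^ 2 - conj u * z‖ := by
  have h1 : ‖(R : ℂ) ^ 2 - conj u * z‖ ^ 2 - (‖z - u‖ * R) ^ 2 =
      (R ^ 2 - ‖z‖ ^ 2) * (R ^ 2 - ‖u‖ ^ 2) := by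
    rw [mul_pow]
    simp only [← Complex.normSq_eq_norm_sq, Complex.normSq_apply]
    simp [pow_two]
    ring
  have h2 : 0 ≤ (R ^ 2 - ‖z‖ ^ 2) * (R ^ 2 - ‖u‖ ^ 2) :=
    mul_nonneg (by nlinarith [norm_nonneg z]) (by nlinarith [norm_nonneg u])
  exact abs_le_of_sq_le_sq' (by linarith) (norm_nonneg _) |>.2

theorem norm_sub_mul_eq_norm_sub_conj_mul {R : ℝ} {z u : ℂ} (hz : ‖z‖ = R) :
    ‖z - u‖ * R = ‖(R : ℂ) ^ 2 - conj u * z‖ := by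
  have h : (R : ℂ) ^ 2 - conj u * z = conj (z - u) * z := by
    rw [map_sub, sub_mul, Complex.conj_mul', hz]
  rw [h, norm_mul, RCLike.norm_conj, hz]

/-- A function analytic on a closed disc and without zeros on its boundary is dominated by a
nonvanishing analytic function having the same modulus on the boundary. -/
theorem exists_nonvanishing_majorant {f : ℂ → ℂ} {R : ℝ} (hR : 0 < R)
    (hf : AnalyticOnNhd ℂ f (closedBall 0 R)) (h0 : ∀ z ∈ sphere (0 : ℂ) R, f z ≠ 0) :
    ∃ h : ℂ → ℂ, AnalyticOnNhd ℂ h (closedBall 0 R) ∧ (∀ z ∈ closedBall (0 : ℂ) R, h z ≠ 0) ∧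
      (∀ z ∈ closedBall (0 : ℂ) R, ‖f z‖ ≤ ‖h z‖) ∧ ∀ z ∈ sphere (0 : ℂ) R, ‖h z‖ = ‖f z‖ := by
  set U := closedBall (0 : ℂ) R
  have hRs : (R : ℂ) ∈ sphere (0 : ℂ) R := by simp [abs_of_pos hR]
  have hpre : IsPreconnected U := (convex_closedBall (0 : ℂ) R).isPreconnected
  have hm : MeromorphicOn f U := hf.meromorphicOn
  have hord : ∀ u : U, meromorphicOrderAt f u ≠ ⊤ := by
    intro u
    refine hm.meromorphicOrderAt_ne_top_of_isPreconnected hpre (sphere_subset_closedBall hRs) u.2 ?_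
    rw [((hf _ (sphere_subset_closedBall hRs)).meromorphicNFAt).meromorphicOrderAt_eq_zero_iff.2
      (h0 _ hRs)]
    exact WithTop.zero_ne_top
  have hfin : (MeromorphicOn.divisor f U).support.Finite :=
    (MeromorphicOn.divisor f U).finiteSupport (isCompact_closedBall 0 R)
  obtain ⟨g, hg, hg0, hfg⟩ := hm.extract_zeros_poles hord hfin
  set D := MeromorphicOn.divisor f U with hD
  have hDnn : ∀ u, 0 ≤ D u := fun u => MeromorphicOn.AnalyticOnNhd.divisor_nonneg hf u
  set S := hfin.toFinset with hS
  set n : ℂ → ℕ := fun u => (D u).toNat with hn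
  have hSball : ∀ u ∈ S, u ∈ ball (0 : ℂ) R := by
    intro u hu
    have hDu : D u ≠ 0 := by simpa [hS] using hu
    have huU : u ∈ U := D.supportWithinDomain hDu
    by_contra hub
    have hus : u ∈ sphere (0 : ℂ) R := by
      rw [mem_sphere_zero_iff_norm]
      exact le_antisymm (mem_closedBall_zero_iff.1 huU)
        (not_lt.1 fun h => hub (mem_ball_zero_iff.2 h))
    apply hDu
    rw [hD, MeromorphicOn.divisor_apply hm huU,
      ((hf u huU).meromorphicNFAt).meromorphicOrderAt_eq_zero_iff.2 (h0 u hus)]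
    rfl
  have hprod : ∀ z, (∏ᶠ u, ((· - u) ^ D u : ℂ → ℂ)) z = ∏ u ∈ S, (z - u) ^ n u := by
    intro z
    rw [finprod_eq_prod_of_mulSupport_subset (s := S) _ ?_, Finset.prod_apply]
    · refine Finset.prod_congr rfl fun u _ => ?_
      rw [Pi.pow_apply, ← zpow_natCast, hn, Int.toNat_of_nonneg (hDnn u)]
    · intro u hu
      rw [hS, Set.Finite.coe_toFinset]
      intro hDu
      exact hu (by simp [hDu])
  have hpa : ∀ x ∈ U, AnalyticAt ℂ (fun z => (∏ u ∈ S, (z - u) ^ n u) * g z) x := by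
    intro x hx
    refine AnalyticAt.mul ?_ (hg x hx)
    fun_prop
  have heq : ∀ x ∈ U, f x = (∏ u ∈ S, (x - u) ^ n u) * g x := by
    intro x hx
    have hacc : AccPt x (𝓟 U) :=
      hpre.preperfect_of_nontrivial ⟨(R : ℂ), sphere_subset_closedBall hRs, 0,
        mem_closedBall_self hR.le, by exact_mod_cast hR.ne'⟩ x hx
    have hpx := hpa x hx
    -- The factorization is known only off a discrete set; continuity of both sides extends it to
    -- all of `U`.
    have hcod : f =ᶠ[codiscreteWithin U] fun z => (∏ u ∈ S, (z - u) ^ n u) * g z := by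
      filter_upwards [hfg] with z hz
      rw [hz, Pi.smul_apply', hprod, smul_eq_mul]
    have hne := (hf x hx).meromorphicAt.eventuallyEq_nhdsNE_of_eventuallyEq_codiscreteWithin
      hpx.meromorphicAt hx hacc hcod
    exact ((hf x hx).continuousAt.eventuallyEq_nhds_iff_eventuallyEq_nhdsNE
      hpx.continuousAt).1 hne |>.eq_of_nhds
  have hRc : (R : ℂ) ≠ 0 := by exact_mod_cast hR.ne'
  have hfac : ∀ z u : ℂ, ‖((R : ℂ) ^ 2 - conj u * z) / R‖ = ‖(R : ℂ) ^ 2 - conj u * z‖ / R := by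
    intro z u
    rw [norm_div, Complex.norm_real, Real.norm_of_nonneg hR.le]
  -- Each `z - u` is divided by its Blaschke factor for radius `R`, which moves the zero outside the
  -- closed disc.
  refine ⟨fun z => (∏ u ∈ S, (((R : ℂ) ^ 2 - conj u * z) / R) ^ n u) * g z, ?_, ?_, ?_, ?_⟩
  · intro x hx
    refine AnalyticAt.mul ?_ (hg x hx)
    fun_prop
  · intro z hz
    refine mul_ne_zero (Finset.prod_ne_zero_iff.2 fun u hu => pow_ne_zero _ ?_) (hg0 ⟨z, hz⟩)
    refine div_ne_zero (fun hzero => ?_) hRc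
    have h1 : ‖conj u * z‖ = R ^ 2 := by
      rw [← sub_eq_zero.1 hzero, norm_pow, Complex.norm_real, Real.norm_of_nonneg hR.le]
    rw [norm_mul, RCLike.norm_conj] at h1
    have h2 : ‖u‖ < R := mem_ball_zero_iff.1 (hSball u hu)
    have h3 : ‖z‖ ≤ R := mem_closedBall_zero_iff.1 hz
    nlinarith [norm_nonneg u, norm_nonneg z]
  · intro z hz
    rw [heq z hz, norm_mul, norm_mul, norm_prod, norm_prod]
    refine mul_le_mul_of_nonneg_right (Finset.prod_le_prod (fun _ _ => norm_nonneg _)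
      fun u hu => ?_) (norm_nonneg _)
    rw [norm_pow, norm_pow, hfac]
    refine pow_le_pow_left₀ (norm_nonneg _) ((le_div_iff₀ hR).2 ?_) _
    exact norm_sub_mul_le_norm_sub_conj_mul hR.le (mem_closedBall_zero_iff.1 hz)
      (mem_ball_zero_iff.1 (hSball u hu)).le
  · intro z hz
    rw [heq z (sphere_subset_closedBall hz), norm_mul, norm_mul, norm_prod, norm_prod]
    congr 1
    refine Finset.prod_congr rfl fun u _ => ?_
    rw [norm_pow, norm_pow, hfac, ← norm_sub_mul_eq_norm_sub_conj_mul (mem_sphere_zero_iff_norm.1 hz),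
      mul_div_cancel_right₀ _ hR.ne']

/-! ### Poisson majorants and Littlewood subordination -/

theorem norm_circleAverage_le (f : ℂ → ℂ) (c : ℂ) (R : ℝ) :
    ‖Real.circleAverage f c R‖ ≤ Real.circleAverage (fun z => ‖f z‖) c R := by
  rw [Real.circleAverage_def, Real.circleAverage_def, norm_smul, smul_eq_mul,
    Real.norm_of_nonneg (by positivity)]
  gcongr
  exact intervalIntegral.norm_integral_le_integral_norm Real.two_pi_pos.le

theorem poissonKernel_nonneg {R : ℝ} {w z : ℂ} (hw : w ∈ ball (0 : ℂ) R)
    (hz : z ∈ sphere (0 : ℂ) R) : 0 ≤ poissonKernel 0 w z := by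
  rw [poissonKernel_def]
  simp only [sub_zero]
  rw [mem_sphere_zero_iff_norm.1 hz]
  have := mem_ball_zero_iff.1 hw
  exact div_nonneg (by nlinarith [norm_nonneg w]) (by positivity)

theorem poissonKernel_le {R : ℝ} {w z : ℂ} (hw : w ∈ ball (0 : ℂ) R)
    (hz : z ∈ sphere (0 : ℂ) R) : poissonKernel 0 w z ≤ (R + ‖w‖) / (R - ‖w‖) := by
  rw [poissonKernel_eq_re_herglotzRieszKernel]
  simpa [herglotzRieszKernel_def] using re_herglotzRieszKernel_le hz hw

/-- The Poisson integral of `‖f‖ ^ p` dominates `‖f‖ ^ p`. -/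
theorem norm_rpow_le_circleAverage_poissonKernel {f : ℂ → ℂ} {R p : ℝ} {w : ℂ}
    (hf : AnalyticOnNhd ℂ f (closedBall 0 R)) (h0 : ∀ z ∈ sphere (0 : ℂ) R, f z ≠ 0)
    (hp : 0 < p) (hw : w ∈ ball (0 : ℂ) R) :
    ‖f w‖ ^ p ≤ Real.circleAverage (fun z => poissonKernel 0 w z * ‖f z‖ ^ p) 0 R := by
  have hR : 0 < R := pos_of_mem_ball hw
  obtain ⟨h, hh, hh0, hle, heq⟩ := exists_nonvanishing_majorant hR hf h0
  have hharm : closedBall (0 : ℂ) R ⊆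
      {z | InnerProductSpace.HarmonicAt (fun z => Real.log ‖h z‖) z} :=
    fun z hz => (hh z hz).harmonicAt_log_norm (hh0 z hz)
  obtain ⟨e, he, hsub⟩ := (isCompact_closedBall (0 : ℂ) R).exists_thickening_subset_open
    (InnerProductSpace.isOpen_setOfPred_harmonicAt _) hharm
  rw [thickening_closedBall he hR.le] at hsub
  -- With `log ‖h‖ = re F`, the analytic function `exp (p * F)` has modulus `‖h‖ ^ p`, so the
  -- Poisson formula applies to it even for `p < 1`.
  obtain ⟨F, hF, hFre⟩ :=
    InnerProductSpace.HarmonicOnNhd.exists_analyticOnNhd_ball_re_eq fun z hz => hsub hz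
  have hcl : closedBall (0 : ℂ) R ⊆ ball 0 (e + R) := closedBall_subset_ball (by linarith)
  have hH : ∀ z ∈ closedBall (0 : ℂ) R, ‖Complex.exp (p * F z)‖ = ‖h z‖ ^ p := by
    intro z hz
    have hre : (F z).re = Real.log ‖h z‖ := hFre (hcl hz)
    rw [Complex.norm_exp, Complex.re_ofReal_mul, hre, mul_comm,
      Real.rpow_def_of_pos (norm_pos_iff.2 (hh0 z hz))]
  have hdiff : DiffContOnCl ℂ (fun z => Complex.exp (p * F z)) (ball 0 R) := by
    refine DifferentiableOn.diffContOnCl ?_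
    rw [closure_ball _ hR.ne']
    exact (((hF.differentiableOn.mono hcl).const_mul _)).cexp
  calc ‖f w‖ ^ p ≤ ‖h w‖ ^ p :=
        Real.rpow_le_rpow (norm_nonneg _) (hle w (ball_subset_closedBall hw)) hp.le
    _ = ‖Complex.exp (p * F w)‖ := (hH w (ball_subset_closedBall hw)).symm
    _ = ‖Real.circleAverage (poissonKernel 0 w • fun z => Complex.exp (p * F z)) 0 R‖ := by
        rw [hdiff.circleAverage_poissonKernel_smul hw]
    _ ≤ _ := norm_circleAverage_le _ _ _
    _ = _ := by
        refine Real.circleAverage_congr_sphere fun z hz => ?_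
        rw [abs_of_pos hR] at hz
        simp only [Pi.smul_apply']
        rw [norm_smul, hH z (sphere_subset_closedBall hz), heq z hz,
          Real.norm_of_nonneg (poissonKernel_nonneg hw hz)]

/-- Littlewood's subordination principle, for a map that need not fix the origin. -/
theorem circleAverage_norm_rpow_comp_le {f Φ : ℂ → ℂ} {r R p : ℝ} (hr : 0 ≤ r)
    (hf : AnalyticOnNhd ℂ f (closedBall 0 R)) (h0 : ∀ z ∈ sphere (0 : ℂ) R, f z ≠ 0)
    (hp : 0 < p) (hΦ : DifferentiableOn ℂ Φ (closedBall 0 r))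
    (hmaps : MapsTo Φ (closedBall 0 r) (ball 0 R)) :
    Real.circleAverage (fun z => ‖f (Φ z)‖ ^ p) 0 r ≤
      (R + ‖Φ 0‖) / (R - ‖Φ 0‖) * Real.circleAverage (fun z => ‖f z‖ ^ p) 0 R := by
  have hw0 : Φ 0 ∈ ball (0 : ℂ) R := hmaps (mem_closedBall_self hr)
  have hR : 0 < R := pos_of_mem_ball hw0
  have hint : CircleIntegrable (fun z => ‖f z‖ ^ p) 0 R := by
    refine ContinuousOn.circleIntegrable hR.le ?_
    exact (hf.continuousOn.mono sphere_subset_closedBall).norm.rpow_const fun _ _ => Or.inr hp.le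
  have hintc : CircleIntegrable (fun z => ((‖f z‖ ^ p : ℝ) : ℂ)) 0 R := by
    refine ContinuousOn.circleIntegrable hR.le ?_
    exact Complex.continuous_ofReal.comp_continuousOn
      ((hf.continuousOn.mono sphere_subset_closedBall).norm.rpow_const fun _ _ => Or.inr hp.le)
  -- `K` is analytic with real part the Poisson integral of `‖f‖ ^ p`, so the mean of `K ∘ Φ` is `K
  -- (Φ 0)`; bounding the Poisson kernel at `Φ 0` gives the constant.
  set K : ℂ → ℂ := fun w =>
    Real.circleAverage (fun ζ => herglotzRieszKernel 0 w ζ • ((‖f ζ‖ ^ p : ℝ) : ℂ)) 0 R with hK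
  have hKre : ∀ w ∈ ball (0 : ℂ) R,
      (K w).re = Real.circleAverage (fun z => poissonKernel 0 w z * ‖f z‖ ^ p) 0 R := by
    intro w hw
    rw [hK, re_circleAverage_herglotzRieszKernel_smul hint hw,
      ← poissonKernel_eq_re_herglotzRieszKernel]
    rfl
  have hPint : ∀ w ∈ ball (0 : ℂ) R,
      CircleIntegrable (fun z => poissonKernel 0 w z * ‖f z‖ ^ p) 0 R := by
    intro w hw
    have hc := continuousOn_herglotzRieszKernel_sphere hw
    rw [abs_of_pos hR] at hc
    rw [poissonKernel_eq_re_herglotzRieszKernel]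
    refine ContinuousOn.circleIntegrable hR.le ?_
    exact (Complex.continuous_re.comp_continuousOn hc).mul
      ((hf.continuousOn.mono sphere_subset_closedBall).norm.rpow_const fun _ _ => Or.inr hp.le)
  have hKΦ : DifferentiableOn ℂ (K ∘ Φ) (closedBall 0 r) :=
    (differentiableOn_circleAverage_herglotzRieszKernel_smul hintc).comp hΦ hmaps
  have hmean : Real.circleAverage (K ∘ Φ) 0 r = K (Φ 0) := by
    refine DiffContOnCl.circleAverage (DifferentiableOn.diffContOnCl ?_)
    rw [abs_of_nonneg hr]
    exact hKΦ.mono closure_ball_subset_closedBall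
  have hKint : CircleIntegrable (K ∘ Φ) 0 r :=
    (hKΦ.continuousOn.mono sphere_subset_closedBall).circleIntegrable hr
  calc Real.circleAverage (fun z => ‖f (Φ z)‖ ^ p) 0 r
      ≤ Real.circleAverage (Complex.reCLM ∘ (K ∘ Φ)) 0 r := by
        refine Real.circleAverage_mono ?_ ?_ fun z hz => ?_
        · refine ContinuousOn.circleIntegrable hr ?_
          refine ((hf.continuousOn.comp hΦ.continuousOn fun z hz =>
            ball_subset_closedBall (hmaps hz)).mono sphere_subset_closedBall).norm.rpow_const
              fun _ _ => Or.inr hp.le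
        · refine ContinuousOn.circleIntegrable hr ?_
          exact Complex.reCLM.continuous.comp_continuousOn
            (hKΦ.continuousOn.mono sphere_subset_closedBall)
        · rw [abs_of_nonneg hr] at hz
          have hz' := hmaps (sphere_subset_closedBall hz)
          exact (norm_rpow_le_circleAverage_poissonKernel hf h0 hp hz').trans_eq
            (hKre _ hz').symm
    _ = (K (Φ 0)).re := by
        rw [Complex.reCLM.circleAverage_comp_comm hKint, hmean, Complex.reCLM_apply]
    _ = Real.circleAverage (fun z => poissonKernel 0 (Φ 0) z * ‖f z‖ ^ p) 0 R := hKre _ hw0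
    _ ≤ Real.circleAverage
          (fun z => ((R + ‖Φ 0‖) / (R - ‖Φ 0‖)) • (fun z => ‖f z‖ ^ p) z) 0 R := by
        refine Real.circleAverage_mono (hPint _ hw0) (hint.const_smul) fun z hz => ?_
        rw [abs_of_pos hR] at hz
        exact mul_le_mul_of_nonneg_right (poissonKernel_le hw0 hz) (by positivity)
    _ = _ := by rw [Real.circleAverage_fun_smul, smul_eq_mul]

/-- An analytic function that is not identically zero on the unit disc has no zeros on some circle
of radius arbitrarily close to `1`. -/
theorem exists_radius_forall_sphere_ne_zero {f : ℂ → ℂ} (hf : AnalyticOnNhd ℂ f (ball 0 1))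
    (hne : ∃ z ∈ ball (0 : ℂ) 1, f z ≠ 0) {s : ℝ} (hs : s < 1) :
    ∃ R ∈ Ioo s 1, ∀ z ∈ sphere (0 : ℂ) R, f z ≠ 0 := by
  obtain ⟨t, hst, ht⟩ := exists_between hs
  have hsub : closedBall (0 : ℂ) t ⊆ ball 0 1 := closedBall_subset_ball ht
  have hfin : (closedBall (0 : ℂ) t ∩ f ⁻¹' {0}).Finite := by
    by_contra hinf
    obtain ⟨x, hx, hacc⟩ := Set.Infinite.exists_accPt_of_subset_isCompact hinf
      (isCompact_closedBall (0 : ℂ) t) inter_subset_left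
    obtain ⟨z, hz, hfz⟩ := hne
    refine hfz (hf.eqOn_zero_of_preconnected_of_frequently_eq_zero
      (convex_ball (0 : ℂ) 1).isPreconnected (hsub hx) ?_ hz)
    exact (accPt_iff_frequently_nhdsNE.1 hacc).mono fun y hy => hy.2
  obtain ⟨R, hR, hR'⟩ := (Ioo_infinite hst).exists_notMem_finite (hfin.image norm)
  refine ⟨R, ⟨hR.1, hR.2.trans ht⟩, fun z hz hz0 => hR' ⟨z, ⟨?_, hz0⟩, mem_sphere_zero_iff_norm.1 hz⟩⟩
  exact mem_closedBall_zero_iff.2 ((mem_sphere_zero_iff_norm.1 hz).trans_le hR.2.le)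

/-- Composition with a holomorphic self-map of the disc preserves boundedness of the `p`-th power
integral means. -/
theorem exists_circleAverage_norm_rpow_comp_le {f Φ : ℂ → ℂ} {p M : ℝ} (hp : 0 < p)
    (hf : AnalyticOnNhd ℂ f (ball 0 1)) (hΦ : DifferentiableOn ℂ Φ (ball 0 1))
    (hmaps : MapsTo Φ (ball 0 1) (ball 0 1))
    (hM : ∀ r ∈ Ico (0 : ℝ) 1, Real.circleAverage (fun z => ‖f z‖ ^ p) 0 r ≤ M) :
    ∃ M', ∀ r ∈ Ico (0 : ℝ) 1, Real.circleAverage (fun z => ‖f (Φ z)‖ ^ p) 0 r ≤ M' := by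
  have hΦ0 : ‖Φ 0‖ < 1 := mem_ball_zero_iff.1 (hmaps (by simp))
  -- Below, `R` is taken above `(1 + ‖Φ 0‖) / 2`, which bounds `(R + ‖Φ 0‖) / (R - ‖Φ 0‖)`
  -- independently of `r`.
  refine ⟨2 / ((1 - ‖Φ 0‖) / 2) * M, fun r hr => ?_⟩
  have hM0 : 0 ≤ M := by
    refine le_trans (Real.circleAverage_nonneg_of_nonneg fun z _ => ?_) (hM 0 (by simp))
    positivity
  by_cases hne : ∃ z ∈ ball (0 : ℂ) 1, f z ≠ 0
  · have hrsub : closedBall (0 : ℂ) r ⊆ ball 0 1 := closedBall_subset_ball hr.2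
    have hcont : ContinuousOn (fun z => ‖Φ z‖) (closedBall 0 r) :=
      (hΦ.continuousOn.mono hrsub).norm
    obtain ⟨z₀, hz₀, hmax⟩ := (isCompact_closedBall (0 : ℂ) r).exists_isMaxOn
      ⟨0, mem_closedBall_self hr.1⟩ hcont
    have hs : max ‖Φ z₀‖ ((1 + ‖Φ 0‖) / 2) < 1 :=
      max_lt (mem_ball_zero_iff.1 (hmaps (hrsub hz₀))) (by linarith)
    obtain ⟨R, ⟨hsR, hR1⟩, hR0⟩ := exists_radius_forall_sphere_ne_zero hf hne hs
    obtain ⟨h1, h2⟩ := max_lt_iff.1 hsR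
    have hR : 0 ≤ R := (norm_nonneg _).trans h1.le
    refine (circleAverage_norm_rpow_comp_le hr.1 (hf.mono (closedBall_subset_ball hR1)) hR0 hp
      (hΦ.mono hrsub) fun z hz => mem_ball_zero_iff.2 ((hmax hz).trans_lt h1)).trans ?_
    refine mul_le_mul ?_ (hM R ⟨hR, hR1⟩) (Real.circleAverage_nonneg_of_nonneg fun z _ => ?_) ?_
    · exact div_le_div₀ zero_le_two (by linarith) (by linarith) (by linarith)
    · positivity
    · exact div_nonneg zero_le_two (by linarith)
  · push Not at hne
    have hz : Real.circleAverage (fun z => ‖f (Φ z)‖ ^ p) 0 r = 0 := by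
      refine Real.circleAverage_const_on_circle fun z hz => ?_
      rw [mem_sphere_zero_iff_norm, abs_of_nonneg hr.1] at hz
      rw [hne _ (hmaps (mem_ball_zero_iff.2 (hz.trans_lt hr.2))), norm_zero,
        Real.zero_rpow hp.ne']
    rw [hz]
    exact mul_nonneg (div_nonneg zero_le_two (by linarith)) hM0

/-! ### Automorphisms are Möbius maps -/

theorem one_add_conj_mul_ne_zero {a w : ℂ} (ha : ‖a‖ < 1) (hw : ‖w‖ < 1) :
    1 + conj a * w ≠ 0 := by
  intro h
  have h1 : ‖conj a * w‖ = 1 := by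
    rw [← norm_neg, ← eq_neg_of_add_eq_zero_left h, norm_one]
  rw [norm_mul, RCLike.norm_conj] at h1
  nlinarith [norm_nonneg a, norm_nonneg w]

theorem norm_add_div_one_add_conj_mul_lt_one {a w : ℂ} (ha : ‖a‖ < 1) (hw : ‖w‖ < 1) :
    ‖(w + a) / (1 + conj a * w)‖ < 1 := by
  have hne := norm_pos_iff.2 (one_add_conj_mul_ne_zero ha hw)
  rw [norm_div, div_lt_one hne]
  have h1 : ‖1 + conj a * w‖ ^ 2 - ‖w + a‖ ^ 2 = (1 - ‖w‖ ^ 2) * (1 - ‖a‖ ^ 2) := by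
    simp only [← Complex.normSq_eq_norm_sq, Complex.normSq_apply]
    simp
    ring
  have h2 : 0 < (1 - ‖w‖ ^ 2) * (1 - ‖a‖ ^ 2) :=
    mul_pos (by nlinarith [norm_nonneg w]) (by nlinarith [norm_nonneg a])
  exact lt_of_pow_lt_pow_left₀ 2 hne.le (by linarith)

theorem differentiableOn_add_div_one_add_conj_mul {a : ℂ} (ha : ‖a‖ < 1) :
    DifferentiableOn ℂ (fun w => (w + a) / (1 + conj a * w)) (ball 0 1) :=
  DifferentiableOn.div (by fun_prop) (by fun_prop)
    fun _ hw => one_add_conj_mul_ne_zero ha (mem_ball_zero_iff.1 hw)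

/-- A holomorphic self-map of the disc with a holomorphic left inverse, both fixing the origin, is a
rotation. -/
theorem exists_eqOn_mul_of_leftInverse {G E : ℂ → ℂ} (hG : DifferentiableOn ℂ G (ball 0 1))
    (hE : DifferentiableOn ℂ E (ball 0 1)) (hGm : MapsTo G (ball 0 1) (ball 0 1))
    (hEm : MapsTo E (ball 0 1) (ball 0 1)) (hG0 : G 0 = 0) (hE0 : E 0 = 0)
    (hEG : ∀ z ∈ ball (0 : ℂ) 1, E (G z) = z) :
    ∃ c : ℂ, ‖c‖ = 1 ∧ EqOn G (fun z => z * c) (ball 0 1) := by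
  have h1 : ((1 / 2 : ℝ) : ℂ) ∈ ball (0 : ℂ) 1 := by
    rw [mem_ball_zero_iff, Complex.norm_real]
    norm_num
  -- Schwarz's lemma for `G` and for `E` gives the two inequalities; its equality case at `1/2` then
  -- yields the rotation.
  have hnorm : ∀ z ∈ ball (0 : ℂ) 1, ‖G z‖ = ‖z‖ := by
    intro z hz
    refine le_antisymm (Complex.norm_le_norm_of_mapsTo_ball hG
      (hGm.mono_right ball_subset_closedBall) hG0 (mem_ball_zero_iff.1 hz)) ?_
    conv_lhs => rw [← hEG z hz]
    exact Complex.norm_le_norm_of_mapsTo_ball hE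
      (hEm.mono_right ball_subset_closedBall) hE0 (mem_ball_zero_iff.1 (hGm hz))
  have hne : ((1 / 2 : ℝ) : ℂ) ≠ 0 := by
    rw [Complex.ofReal_ne_zero]
    norm_num
  have hds : ‖dslope G 0 ((1 / 2 : ℝ) : ℂ)‖ = 1 := by
    rw [dslope_of_ne _ hne, slope_def_field, hG0, sub_zero, sub_zero, norm_div, hnorm _ h1,
      div_self (norm_ne_zero_iff.2 hne)]
  refine ⟨_, hds, fun z hz => ?_⟩
  have h2 := Complex.affine_of_mapsTo_ball_of_norm_dslope_eq_div hG
    (by rw [hG0]; exact hGm.mono_right ball_subset_closedBall) h1 (by rw [hds, div_one]) hz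
  simpa [hG0] using h2

theorem ext_mapsTo_ball (φ : 𝔻 → 𝔻) :
    MapsTo (ext fun z => (φ z : ℂ)) (ball 0 1) (ball 0 1) := by
  intro z hz
  obtain ⟨z, rfl⟩ := exists_coe_eq hz
  rw [ext_coe]
  exact coe_mem_ball _

/-- Moving `a = φ 0` to the origin by a Möbius map turns `φ` into a rotation by some `c`. Hence `φ`
is explicit, and `|φ'| = (1 - |a|²) / |1 + conj a * c * z|²`. -/
theorem IsAutomorphism.exists_norm_deriv_le {φ : 𝔻 → 𝔻} (h : IsAutomorphism φ) :
    ∃ C, ∀ z ∈ ball (0 : ℂ) 1, ‖deriv (ext fun z => (φ z : ℂ)) z‖ ≤ C := by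
  obtain ⟨hφ, σ, hσ, hl, -⟩ := h
  set Φ : ℂ → ℂ := ext fun z => (φ z : ℂ) with hΦ
  set S : ℂ → ℂ := ext fun z => (σ z : ℂ) with hS
  have hΦm : MapsTo Φ (ball 0 1) (ball 0 1) := ext_mapsTo_ball φ
  have hSm : MapsTo S (ball 0 1) (ball 0 1) := ext_mapsTo_ball σ
  have hSΦ : ∀ z ∈ ball (0 : ℂ) 1, S (Φ z) = z := by
    intro z hz
    obtain ⟨z, rfl⟩ := exists_coe_eq hz
    rw [hΦ, hS, ext_coe, ext_coe, hl z]
  set a : ℂ := Φ 0 with ha'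
  have h00 : (0 : ℂ) ∈ ball (0 : ℂ) 1 := by simp
  have ha : ‖a‖ < 1 := mem_ball_zero_iff.1 (hΦm h00)
  have hna : ‖-a‖ < 1 := by rwa [norm_neg]
  have hmm : ∀ w ∈ ball (0 : ℂ) 1,
      ((w + -a) / (1 + conj (-a) * w) + a) / (1 + conj a * ((w + -a) / (1 + conj (-a) * w))) =
        w := by
    intro w hw
    have hw' := mem_ball_zero_iff.1 hw
    have h1 := one_add_conj_mul_ne_zero hna hw'
    have h2 := one_add_conj_mul_ne_zero ha (norm_add_div_one_add_conj_mul_lt_one hna hw')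
    have h3 := div_mul_cancel₀ (w + -a) h1
    rw [div_eq_iff h2]
    generalize (w + -a) / (1 + conj (-a) * w) = q at h3 ⊢
    rw [map_neg] at h3
    linear_combination h3
  obtain ⟨c, hc, hcG⟩ := exists_eqOn_mul_of_leftInverse
    (G := fun z => (Φ z + -a) / (1 + conj (-a) * Φ z))
    (E := fun w => S ((w + a) / (1 + conj a * w)))
    ((differentiableOn_add_div_one_add_conj_mul hna).comp hφ hΦm)
    (DifferentiableOn.comp hσ (differentiableOn_add_div_one_add_conj_mul ha) fun w hw =>
      mem_ball_zero_iff.2 (norm_add_div_one_add_conj_mul_lt_one ha (mem_ball_zero_iff.1 hw)))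
    (fun z hz => mem_ball_zero_iff.2
      (norm_add_div_one_add_conj_mul_lt_one hna (mem_ball_zero_iff.1 (hΦm hz))))
    (fun w hw => hSm (mem_ball_zero_iff.2
      (norm_add_div_one_add_conj_mul_lt_one ha (mem_ball_zero_iff.1 hw))))
    (by simp [← ha']) (by simpa using hSΦ 0 h00)
    (fun z hz => by
      rw [hmm _ (hΦm hz), hSΦ z hz])
  have hΦeq : EqOn Φ (fun z => (z * c + a) / (1 + conj a * (z * c))) (ball 0 1) := by
    intro z hz
    have h1 := hmm _ (hΦm hz)
    have h2 : (Φ z + -a) / (1 + conj (-a) * Φ z) = z * c := hcG hz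
    rw [h2] at h1
    exact h1.symm
  refine ⟨2 / (1 - ‖a‖) ^ 2, fun z hz => ?_⟩
  have hzc : ‖z * c‖ < 1 := by rw [norm_mul, hc, mul_one]; exact mem_ball_zero_iff.1 hz
  have hne := one_add_conj_mul_ne_zero ha hzc
  have hd : HasDerivAt (fun z => (z * c + a) / (1 + conj a * (z * c)))
      ((c * (1 + conj a * (z * c)) - (z * c + a) * (conj a * c)) / (1 + conj a * (z * c)) ^ 2)
      z := by
    have h1 : HasDerivAt (fun z => z * c) c z := by simpa using (hasDerivAt_id z).mul_const c
    exact (h1.add_const a).div ((h1.const_mul (conj a)).const_add 1) hne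
  rw [(hΦeq.eventuallyEq_of_mem (isOpen_ball.mem_nhds hz)).deriv_eq, hd.deriv, norm_div, norm_pow]
  have hnum : c * (1 + conj a * (z * c)) - (z * c + a) * (conj a * c) =
      c * (1 - ((‖a‖ ^ 2 : ℝ) : ℂ)) := by
    push_cast
    rw [← Complex.conj_mul']
    ring
  have hden : 1 - ‖a‖ ≤ ‖1 + conj a * (z * c)‖ := by
    have h1 := norm_sub_le_norm_add (1 : ℂ) (conj a * (z * c))
    rw [norm_one, norm_mul (conj a), RCLike.norm_conj] at h1
    nlinarith [norm_nonneg a]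
  rw [hnum, norm_mul, hc, one_mul]
  refine div_le_div₀ zero_le_two ?_ (by have := sub_pos.2 ha; positivity)
    (pow_le_pow_left₀ (sub_nonneg.2 ha.le) hden 2)
  calc ‖(1 : ℂ) - ((‖a‖ ^ 2 : ℝ) : ℂ)‖ ≤ ‖(1 : ℂ)‖ + ‖((‖a‖ ^ 2 : ℝ) : ℂ)‖ := norm_sub_le _ _
    _ ≤ 2 := by
      rw [norm_one, Complex.norm_real, Real.norm_of_nonneg (by positivity)]
      nlinarith [norm_nonneg a]

/-! ### Invertibility on `S^p` -/

theorem IsAutomorphism.mapsTo_compOp {p : ℝ} (hp : 0 < p) {φ : 𝔻 → 𝔻} (h : IsAutomorphism φ) :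
    MapsTo (compOp φ) (spaceS p) (spaceS p) := by
  intro f hf
  obtain ⟨C, hC⟩ := h.exists_norm_deriv_le
  set Φ : ℂ → ℂ := ext fun z => (φ z : ℂ) with hΦ
  have hΦd : DifferentiableOn ℂ Φ (ball 0 1) := h.1
  have hΦm : MapsTo Φ (ball 0 1) (ball 0 1) := ext_mapsTo_ball φ
  have hfd : DifferentiableOn ℂ (ext f) (ball 0 1) := hf.1
  obtain ⟨M, hM⟩ := (mem_spaceS_iff hfd fun z => (ext_coe f z).symm).1 hf
  have hfd' : DifferentiableOn ℂ (deriv (ext f)) (ball 0 1) := hfd.deriv isOpen_ball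
  obtain ⟨M', hM'⟩ := exists_circleAverage_norm_rpow_comp_le hp
    (hfd'.analyticOnNhd isOpen_ball) hΦd hΦm hM
  have hcd : DifferentiableOn ℂ (ext f ∘ Φ) (ball 0 1) := hfd.comp hΦd hΦm
  refine (mem_spaceS_iff (U := ext f ∘ Φ) hcd fun z => ?_).2 ⟨C ^ p * M', fun r hr => ?_⟩
  · rw [Function.comp_apply, hΦ, ext_coe, ext_coe]
    rfl
  · have hC0 : 0 ≤ C := (norm_nonneg _).trans (hC 0 (by simp))
    have hr' : |r| < 1 := (abs_of_nonneg hr.1).trans_lt hr.2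
    calc Real.circleAverage (fun z => ‖deriv (ext f ∘ Φ) z‖ ^ p) 0 r
        ≤ Real.circleAverage (fun z => C ^ p • (fun z => ‖deriv (ext f) (Φ z)‖ ^ p) z) 0 r := by
          refine Real.circleAverage_mono
            (circleIntegrable_norm_rpow hp.le (hcd.deriv isOpen_ball).continuousOn hr')
            (CircleIntegrable.const_smul (circleIntegrable_norm_rpow hp.le
              (hfd'.continuousOn.comp hΦd.continuousOn hΦm) hr')) fun z hz => ?_
          have hz' : z ∈ ball (0 : ℂ) 1 :=
            mem_ball_zero_iff.2 ((mem_sphere_zero_iff_norm.1 hz).trans_lt hr')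
          rw [deriv_comp z (hfd.differentiableAt (isOpen_ball.mem_nhds (hΦm hz')))
            (hΦd.differentiableAt (isOpen_ball.mem_nhds hz')), norm_mul,
            Real.mul_rpow (norm_nonneg _) (norm_nonneg _), smul_eq_mul, mul_comm]
          gcongr
          exact hC z hz'
      _ = C ^ p * Real.circleAverage (fun z => ‖deriv (ext f) (Φ z)‖ ^ p) 0 r := by
          rw [Real.circleAverage_fun_smul, smul_eq_mul]
      _ ≤ C ^ p * M' := by
          gcongr
          exact hM' r hr

theorem IsAutomorphism.exists_inverse {φ : 𝔻 → 𝔻} (h : IsAutomorphism φ) :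
    ∃ σ : 𝔻 → 𝔻, IsAutomorphism σ ∧ Function.LeftInverse σ φ ∧ Function.RightInverse σ φ := by
  obtain ⟨hφ, σ, hσ, hl, hr⟩ := h
  exact ⟨σ, ⟨hσ, φ, hφ, hr, hl⟩, hl, hr⟩

theorem InvertibleOn.isAutomorphism {p : ℝ} (hp : 0 < p) {φ : 𝔻 → 𝔻}
    (hφ : Holomorphic (fun z => (φ z : ℂ))) {ψ : 𝔻 → ℂ}
    (h : InvertibleOn (weightedCompOp ψ φ) (spaceS p)) : IsAutomorphism φ := by
  obtain ⟨-, R, hR, -, hRr⟩ := h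
  exact isAutomorphism_of_surjOn hp hφ fun g hg => ⟨R g, hR hg, congrFun (hRr hg)⟩

theorem compOp_eq_weightedCompOp (φ : 𝔻 → 𝔻) : compOp φ = weightedCompOp (fun _ => 1) φ := by
  funext f z
  simp [compOp, weightedCompOp]

theorem IsAutomorphism.invertibleOn_compOp {p : ℝ} (hp : 0 < p) {φ : 𝔻 → 𝔻}
    (h : IsAutomorphism φ) : InvertibleOn (compOp φ) (spaceS p) := by
  obtain ⟨σ, hσ, hl, hr⟩ := h.exists_inverse
  refine ⟨h.mapsTo_compOp hp, compOp σ, hσ.mapsTo_compOp hp, fun f _ => ?_, fun f _ => ?_⟩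
  · funext z
    simp [compOp, hr z]
  · funext z
    simp [compOp, hl z]

/-- With `σ` the inverse of `φ` and `R` that of `W`, the multiplier properties come from `ψ f = W
(C_σ f)` and `f / ψ = C_φ (R f)`; conversely `f ↦ C_σ (f / ψ)` inverts `W`. -/
theorem invertibleOn_weightedCompOp_iff {p : ℝ} (hp : 0 < p) {φ : 𝔻 → 𝔻}
    (hφ : Holomorphic (fun z => (φ z : ℂ))) (ψ : 𝔻 → ℂ) :
    InvertibleOn (weightedCompOp ψ φ) (spaceS p) ↔
      IsAutomorphism φ ∧ IsMultiplier ψ (spaceS p) ∧ (∀ z, ψ z ≠ 0) ∧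
        IsMultiplier (fun z => 1 / ψ z) (spaceS p) := by
  constructor
  · intro h
    have hA := h.isAutomorphism hp hφ
    obtain ⟨σ, hσ, hl, hr⟩ := hA.exists_inverse
    obtain ⟨hT, R, hR, -, hRr⟩ := h
    have hRr' : ∀ f ∈ spaceS p, ∀ z, ψ z * R f (φ z) = f z := fun f hf => congrFun (hRr hf)
    have hψ : ∀ z, ψ z ≠ 0 := fun z hz => by
      simpa [hz] using hRr' _ (one_mem_spaceS hp) z
    refine ⟨hA, fun f hf => ?_, hψ, fun f hf => ?_⟩
    · have h1 : ψ * f = weightedCompOp ψ φ (compOp σ f) := by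
        funext z
        simp [weightedCompOp, compOp, hl z]
      rw [h1]
      exact hT (hσ.mapsTo_compOp hp hf)
    · have h1 : (fun z => 1 / ψ z) * f = compOp φ (R f) := by
        funext z
        rw [Pi.mul_apply, ← hRr' f hf z, ← mul_assoc, one_div_mul_cancel (hψ z), one_mul]
        rfl
      rw [h1]
      exact hA.mapsTo_compOp hp (hR hf)
  · rintro ⟨hA, hM, hψ, hM'⟩
    obtain ⟨σ, hσ, hl, hr⟩ := hA.exists_inverse
    refine ⟨fun f hf => hM _ (hA.mapsTo_compOp hp hf),
      fun f => compOp σ ((fun z => 1 / ψ z) * f),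
      fun f hf => hσ.mapsTo_compOp hp (hM' f hf), fun f _ => ?_, fun f _ => ?_⟩
    · funext z
      simp [weightedCompOp, compOp, hr z, hψ]
    · funext z
      simp [weightedCompOp, compOp, hl z, hψ]

end DiscSpaces

open scoped Complex.UnitDisc in
/-- The function `1/ψ` makes sense on the disc only when `ψ` has no zero there; since division by
zero is zero in Lean, this is spelled out. -/
theorem theorem3p1 (p : ℝ) (hp : 0 < p) (φ : 𝔻 → 𝔻)
    (hφ : DiscSpaces.Holomorphic (fun z => (φ z : ℂ))) :
    (DiscSpaces.InvertibleOn (DiscSpaces.compOp φ) (DiscSpaces.spaceS p) ↔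
      DiscSpaces.IsAutomorphism φ) ∧
    ∀ ψ : 𝔻 → ℂ, DiscSpaces.Holomorphic ψ →
      (DiscSpaces.InvertibleOn (DiscSpaces.weightedCompOp ψ φ) (DiscSpaces.spaceS p) ↔
        DiscSpaces.IsAutomorphism φ ∧
        DiscSpaces.IsMultiplier ψ (DiscSpaces.spaceS p) ∧
        (∀ z, ψ z ≠ 0) ∧
        DiscSpaces.IsMultiplier (fun z => 1 / ψ z) (DiscSpaces.spaceS p)) := by
  refine ⟨⟨fun h => ?_, fun h => h.invertibleOn_compOp hp⟩, fun ψ _ =>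
    DiscSpaces.invertibleOn_weightedCompOp_iff hp hφ ψ⟩
  rw [DiscSpaces.compOp_eq_weightedCompOp] at h
  exact h.isAutomorphism hp hφ
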